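/- **Setting.** Consider a POMDP with finite state, observation and action sets $\mathsf S,\mathsf Y,\mathsf A$, times $t=1,2,\dots$, a joint law of $(s_1,y_1)$, transition law $P(s_{t+1},y_{t+1}\mid s_t,a_t)$, rewards $R_t=r(s_t,a_t)\in[0,R_{\max}]$ and discount factor $\gamma\in[0,1)$. Let $h_t=(y_{1:t},a_{1:t-1})$ denote histories; only *reachable* histories are considered, i.e. those whose observations have positive probability when their actions are applied. Let $\mathsf Z$ be a finite agent-state set, $z_{t+1}=\phi(z_t,y_{t+1},a_t)$ with initial value $z_0$ and a dummy action $a_0$, and let $\sigma_t$ be the map $h_t\mapsto z_t$ obtained by unrolling $\phi$. Fix a period $L\ge 1$, put $\mathcal L=\{0,\dots,L-1\}$, $[t]=t\bmod L$, and let $\mu=(\mu^0,\dots,\mu^{L-1})$ be a periodic stochastic agent-state based behavior policy, $a_t\sim\mu^{[t]}(\cdot\mid z_t)$. Assume that under $\mu$ the Markov chain $(S_t,Y_t,Z_t,A_t)$ has a cyclic limiting distribution $(\zeta^0,\dots,\zeta^{L-1})$, that is, the law at time $kL+\ell$ converges to $\zeta^\ell$ as $k\to\infty$, and that $\sum_{s,y}\zeta^\ell(s,y,z,a)>0$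 for all $(\ell,z,a)$. Write $\zeta^\ell(s\mid z)$ and $\zeta^\ell(s\mid z,a)$ for its conditional distributions, and set $$r^\ell_\mu(z,a)=\sum_s r(s,a)\,\zeta^\ell(s\mid z),\qquad P^\ell_\mu(z'\mid z,a)=\sum_{s,y'}\mathbf 1\{z'=\phi(z,y',a)\}\,P(y'\mid s,a)\,\zeta^\ell(s\mid z).$$ Let $(Q^0_\mu,\dots,Q^{L-1}_\mu)$ be the PASQL limit, i.e. the unique solution of $$Q^\ell_\mu(z,a)=r^\ell_\mu(z,a)+\gamma\sum_{z'}P^\ell_\mu(z'\mid z,a)\max_{a'}Q^{[\ell+1]}_\mu(z',a')\qquad\text{for all }(\ell,z,a),$$ let $V^\ell_\mu(z)=\max_a Q^\ell_\mu(z,a)$, let $\pi^\ell_\mu(z)\in\arg\max_a Q^\ell_\mu(z,a)$ be any greedy selection, and let $\vec\pi_\mu$ be the history-dependent policy $\vec\pi_{\mu,t}(h_t)=\pi_\mu^{[t]}(\sigma_t(h_t))$. For a history-dependent (possibly randomized) policy $\vec\pi$ let $V^{\vec\pi}_t(h_t)=\mathbb E^{\vec\pi}\bigl[\sum_{\tau\ge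 t}\gamma^{\tau}R_\tau\mid h_t\bigr]$ and $V^\star_t(h_t)=\sup_{\vec\pi}V^{\vec\pi}_t(h_t)$. Let $\mathcal F$ be a convex and balanced set of real-valued functions on $\mathsf Z$, and put $d_{\mathcal F}(\xi_1,\xi_2)=\sup_{f\in\mathcal F}\bigl|\int f\,d\xi_1-\int f\,d\xi_2\bigr|$ and $\rho_{\mathcal F}(f)=\inf\{\rho>0: f/\rho\in\mathcal F\}$ (with $\inf\emptyset=\infty$). With $\mathcal T(t,\ell)=\{\tau\ge t:[\tau]=\ell\}$, define $$\varepsilon^\ell_t=\sup_{\tau\in\mathcal T(t,\ell)}\ \sup_{h_\tau,a_\tau}\Bigl|\mathbb E[R_\tau\mid h_\tau,a_\tau]-\sum_s r(s,a_\tau)\,\zeta^\ell(s\mid\sigma_\tau(h_\tau),a_\tau)\Bigr|,$$ $$\delta^\ell_t=\sup_{\tau\in\mathcal T(t,\ell)}\ \sup_{h_\tau,a_\tau} d_{\mathcal F}\bigl(\mathbb P(Z_{\tau+1}=\cdot\mid h_\tau,a_\tau),\ P^\ell_\mu(\cdot\mid\sigma_\tau(h_\tau),a_\tau)\bigr).$$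 **Theorem.** For every $t\ge1$, $$\sup_{h_t}\bigl[V^\star_t(h_t)-V^{\vec\pi_\mu}_t(h_t)\bigr]\le\frac{2}{1-\gamma^L}\sum_{\ell\in\mathcal L}\gamma^\ell\Bigl[\varepsilon^{[t+\ell]}_{t+\ell}+\gamma\,\delta^{[t+\ell]}_{t+\ell}\,\rho_{\mathcal F}\bigl(V^{[t+\ell+1]}_\mu\bigr)\Bigr],$$ where a product $\delta\rho$ is $\infty$ as soon as one of its factors is (and terms with coefficient $\gamma=0$ vanish). The same bound holds if the value functions are defined with the weights $\gamma^{\tau-t}$ instead of $\gamma^\tau$. -/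

import Mathlib

open Filter Topology
open scoped ENNReal

noncomputable section

namespace PASQL

/-- A finite POMDP. Time starts at `1`. `init` is the joint law of the initial state `s₁` and the
first observation `y₁`; `trans s a` is the law `P(· | s, a)` of the pair `(s_{t+1}, y_{t+1})` given
`(s_t, a_t) = (s, a)`; the reward at time `t` is `reward s_t a_t`. -/
structure POMDP (S Y A : Type*) [Fintype S] [Fintype Y] where
  init : stdSimplex ℝ (S × Y)
  trans : S → A → stdSimplex ℝ (S × Y)
  reward : S → A → ℝ
  rewardMax : ℝ
  reward_mem : ∀ s a, reward s a ∈ Set.Icc 0 rewardMax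
  discount : ℝ
  discount_nonneg : 0 ≤ discount
  discount_lt_one : discount < 1

/-- The agent state: update function `φ`, initial value `z₀` and the dummy action `a₀`. -/
structure AgentState (Y A Z : Type*) where
  update : Z → Y → A → Z
  start : Z
  dummy : A

/-- Histories `h_t = (y_{1:t}, a_{1:t-1})`: `start y₁` is the history at time `1`, and
`snoc h_t a_t y_{t+1}` is the history at time `t + 1`. -/
inductive History (Y A : Type*) where
  | start (y : Y) : History Y A
  | snoc (h : History Y A) (a : A) (y : Y) : History Y A

/-- The time `t` of a history `h_t`. -/
def History.time {Y A : Type*} : History Y A → ℕ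
  | .start _ => 1
  | .snoc h _ _ => h.time + 1

/-- The map `σ_t` from histories to agent states, obtained by unrolling the update function. -/
def AgentState.unroll {Y A Z : Type*} (G : AgentState Y A Z) : History Y A → Z
  | .start y => G.update G.start y G.dummy
  | .snoc h a y => G.update (G.unroll h) y a

/-- A history dependent, possibly randomized policy: the law of `a_t` given `h_t`
(the time `t` is determined by the history). -/
abbrev Policy (Y A : Type*) [Fintype A] := History Y A → stdSimplex ℝ A

/-- `t mod L` as an element of `{0, …, L-1}`. -/
def phase (L : ℕ) [NeZero L] (t : ℕ) : Fin L := Fin.ofNat L t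

section Model

variable {S Y Z A : Type*} [Fintype S] [Fintype Y] [Fintype Z] [Fintype A]

/-- The probability of observing `y_{1:t}` and being in state `s_t = s` when the actions
`a_{1:t-1}` are applied. -/
def POMDP.weight (M : POMDP S Y A) : History Y A → S → ℝ
  | .start y, s => M.init (s, y)
  | .snoc h a y, s' => ∑ s, M.weight h s * M.trans s a (s', y)

/-- A history is reachable if it has positive probability under some policy, i.e. if its
observations have positive probability when its actions are applied. -/
def POMDP.Reachable (M : POMDP S Y A) (h : History Y A) : Prop :=
  0 < ∑ s, M.weight h s

/-- The conditional probability `ℙ(s_t = s | h_t)`. It does not depend on the policy. -/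
def POMDP.belief (M : POMDP S Y A) (h : History Y A) (s : S) : ℝ :=
  M.weight h s / ∑ s', M.weight h s'

/-- `𝔼[R_t | h_t, a_t]`. -/
def POMDP.condReward (M : POMDP S Y A) (h : History Y A) (a : A) : ℝ :=
  ∑ s, M.belief h s * M.reward s a

/-- `ℙ(Z_{t+1} = z' | h_t, a_t)`. -/
def nextAgentLaw [DecidableEq Z] (M : POMDP S Y A) (G : AgentState Y A Z)
    (h : History Y A) (a : A) (z' : Z) : ℝ :=
  ∑ s, M.belief h s *
    ∑ x : S × Y, M.trans s a x * (if z' = G.update (G.unroll h) x.2 a then 1 else 0)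

/-- `𝔼^π[R_{t+n} | h_t = h, s_t = s]`, where from time `t` on the actions are chosen by the
policy `π`. -/
def POMDP.expReward (M : POMDP S Y A) (π : Policy Y A) : ℕ → History Y A → S → ℝ
  | 0, h, s => ∑ a, π h a * M.reward s a
  | n + 1, h, s => ∑ a, π h a *
      ∑ x : S × Y, M.trans s a x * M.expReward π n (h.snoc a x.2) x.1

/-- The value function `𝔼^π[∑_{τ ≥ t} γ^(k + τ - t) R_τ | h_t]` of a policy started from the
history `h = h_t` at time `t`. With `k = t` the weights are `γ^τ`; with `k = 0` they are
`γ^(τ - t)`. -/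
def POMDP.value (M : POMDP S Y A) (k : ℕ) (π : Policy Y A) (h : History Y A) : ℝ :=
  ∑' n : ℕ, M.discount ^ (k + n) * ∑ s, M.belief h s * M.expReward π n h s

/-- The optimal value: supremum over all history dependent policies. -/
def POMDP.optValue (M : POMDP S Y A) (k : ℕ) (h : History Y A) : ℝ :=
  ⨆ π : Policy Y A, M.value k π h

/-- The history dependent policy `h_t ↦ g^{t mod L}(σ_t(h_t))` given by a deterministic periodic
agent-state based policy `g`. -/
def liftPolicy [DecidableEq A] {L : ℕ} [NeZero L] (G : AgentState Y A Z)
    (g : Fin L → Z → A) : Policy Y A :=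
  fun h => stdSimplex.vertex (g (phase L h.time) (G.unroll h))

/-- The law of `(S_t, Y_t, Z_t, A_t)` when the agent follows the periodic stochastic agent-state
based policy `μ`. Time starts at `1`; the value at `t = 0` is not used. -/
def behaviorLaw [DecidableEq Z] {L : ℕ} [NeZero L] (M : POMDP S Y A) (G : AgentState Y A Z)
    (μ : Fin L → Z → stdSimplex ℝ A) : ℕ → S → Y → Z → A → ℝ
  | 0 => fun _ _ _ _ => 0
  | 1 => fun s y z a =>
      M.init (s, y) * (if z = G.update G.start y G.dummy then 1 else 0) * μ (phase L 1) z a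
  | t + 2 => fun s' y' z' a' =>
      ∑ s, ∑ y, ∑ z, ∑ a, behaviorLaw M G μ (t + 1) s y z a * M.trans s a (s', y') *
        (if z' = G.update z y' a then 1 else 0) * μ (phase L (t + 2)) z' a'

/-- The Markov chain `(S_t, Y_t, Z_t, A_t)` under the behavior policy `μ` converges to the cyclic
limiting distribution `(ζ^0, …, ζ^{L-1})`, which charges every `(ℓ, z, a)`. -/
structure IsCyclicLimit [DecidableEq Z] {L : ℕ} [NeZero L] (M : POMDP S Y A)
    (G : AgentState Y A Z) (μ : Fin L → Z → stdSimplex ℝ A)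
    (ζ : Fin L → S → Y → Z → A → ℝ) : Prop where
  tendsto : ∀ ℓ : Fin L, Tendsto (fun k : ℕ => behaviorLaw M G μ (k * L + ℓ)) atTop (𝓝 (ζ ℓ))
  pos : ∀ ℓ z a, 0 < ∑ s, ∑ y, ζ ℓ s y z a

section Limit

variable {L : ℕ} (ζ : Fin L → S → Y → Z → A → ℝ)

/-- The conditional distribution `ζ^ℓ(s | z)`. -/
def condState (ℓ : Fin L) (z : Z) (s : S) : ℝ :=
  (∑ y, ∑ a, ζ ℓ s y z a) / ∑ s', ∑ y, ∑ a, ζ ℓ s' y z a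

/-- The conditional distribution `ζ^ℓ(s | z, a)`. -/
def condStateAct (ℓ : Fin L) (z : Z) (a : A) (s : S) : ℝ :=
  (∑ y, ζ ℓ s y z a) / ∑ s', ∑ y, ζ ℓ s' y z a

/-- The periodic reward `r^ℓ_μ(z, a)`. -/
def periodicReward (M : POMDP S Y A) (ℓ : Fin L) (z : Z) (a : A) : ℝ :=
  ∑ s, M.reward s a * condState ζ ℓ z s

/-- The periodic dynamics `P^ℓ_μ(z' | z, a)`. -/
def periodicTrans [DecidableEq Z] (M : POMDP S Y A) (G : AgentState Y A Z)
    (ℓ : Fin L) (z : Z) (a : A) (z' : Z) : ℝ :=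
  ∑ s, ∑ y', (if z' = G.update z y' a then 1 else 0) *
    (∑ s', M.trans s a (s', y')) * condState ζ ℓ z s

/-- The right-hand side of the dynamic program of the periodic MDP with rewards `r^ℓ_μ` and
dynamics `P^ℓ_μ`. -/
def periodicBellman [NeZero L] [DecidableEq Z] (M : POMDP S Y A) (G : AgentState Y A Z)
    (Q : Fin L → Z → A → ℝ) : Fin L → Z → A → ℝ := fun ℓ z a =>
  periodicReward ζ M ℓ z a + M.discount *
    ∑ z', periodicTrans ζ M G ℓ z a z' * ⨆ a', Q (phase L (ℓ + 1)) z' a'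

end Limit

theorem behaviorLaw_nonneg [DecidableEq Z] {L : ℕ} [NeZero L] (M : POMDP S Y A)
    (G : AgentState Y A Z) (μ : Fin L → Z → stdSimplex ℝ A) :
    ∀ (t : ℕ) (s : S) (y : Y) (z : Z) (a : A), 0 ≤ behaviorLaw M G μ t s y z a
  | 0, _, _, _, _ => by simp [behaviorLaw]
  | 1, s, y, z, a => by
      have h1 := M.init.2.1 (s, y)
      have h2 := (μ (phase L 1) z).2.1 a
      simp only [behaviorLaw]
      split_ifs <;> simp
      exact mul_nonneg h1 h2
  | t + 2, s', y', z', a' => by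
      simp only [behaviorLaw]
      refine Finset.sum_nonneg fun s _ => Finset.sum_nonneg fun y _ => Finset.sum_nonneg fun z _ =>
        Finset.sum_nonneg fun a _ => ?_
      have h0 := behaviorLaw_nonneg M G μ (t + 1) s y z a
      have h1 := (M.trans s a).2.1 (s', y')
      have h2 := (μ (phase L (t + 2)) z').2.1 a'
      split_ifs <;> simp
      exact mul_nonneg (mul_nonneg h0 h1) h2

section Fixed

variable [DecidableEq Z] {L : ℕ} [NeZero L] {M : POMDP S Y A} {G : AgentState Y A Z}
  {μ : Fin L → Z → stdSimplex ℝ A} {ζ : Fin L → S → Y → Z → A → ℝ}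

theorem IsCyclicLimit.nonneg (hζ : IsCyclicLimit M G μ ζ) (ℓ : Fin L) (s : S) (y : Y) (z : Z)
    (a : A) : 0 ≤ ζ ℓ s y z a := by
  have h := hζ.tendsto ℓ
  rw [tendsto_pi_nhds] at h
  have h := tendsto_pi_nhds.1 (tendsto_pi_nhds.1 (tendsto_pi_nhds.1 (h s) y) z) a
  exact ge_of_tendsto' h fun k => behaviorLaw_nonneg M G μ _ s y z a

theorem IsCyclicLimit.condState_nonneg (hζ : IsCyclicLimit M G μ ζ) (ℓ : Fin L) (z : Z) (s : S) :
    0 ≤ condState ζ ℓ z s :=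
  div_nonneg (Finset.sum_nonneg fun _ _ => Finset.sum_nonneg fun _ _ => hζ.nonneg _ _ _ _ _)
    (Finset.sum_nonneg fun _ _ => Finset.sum_nonneg fun _ _ => Finset.sum_nonneg fun _ _ =>
      hζ.nonneg _ _ _ _ _)

theorem IsCyclicLimit.sum_condState (hζ : IsCyclicLimit M G μ ζ) (ℓ : Fin L) (z : Z) :
    ∑ s, condState ζ ℓ z s = 1 := by
  have hpos : 0 < ∑ s', ∑ y, ∑ a, ζ ℓ s' y z a :=
    (hζ.pos ℓ z G.dummy).trans_le (Finset.sum_le_sum fun s _ => Finset.sum_le_sum fun y _ =>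
      Finset.single_le_sum (f := fun a => ζ ℓ s y z a) (fun a _ => hζ.nonneg ℓ s y z a)
        (Finset.mem_univ _))
  simp only [condState]
  rw [← Finset.sum_div, div_self hpos.ne']

theorem IsCyclicLimit.periodicTrans_nonneg (hζ : IsCyclicLimit M G μ ζ) (ℓ : Fin L) (z : Z)
    (a : A) (z' : Z) : 0 ≤ periodicTrans ζ M G ℓ z a z' := by
  refine Finset.sum_nonneg fun s _ => Finset.sum_nonneg fun y _ =>
    mul_nonneg (mul_nonneg ?_ (Finset.sum_nonneg fun s' _ => (M.trans s a).2.1 _))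
      (hζ.condState_nonneg ℓ z s)
  split_ifs <;> simp

theorem IsCyclicLimit.sum_periodicTrans (hζ : IsCyclicLimit M G μ ζ) (ℓ : Fin L) (z : Z)
    (a : A) : ∑ z', periodicTrans ζ M G ℓ z a z' = 1 := by
  have hP : ∀ s, ∑ y', ∑ s', M.trans s a (s', y') = 1 := fun s => by
    rw [Finset.sum_comm, ← Fintype.sum_prod_type']
    exact (M.trans s a).2.2
  simp only [periodicTrans]
  rw [Finset.sum_comm]
  refine Eq.trans (Finset.sum_congr rfl fun s _ => ?_) (hζ.sum_condState ℓ z)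
  rw [Finset.sum_comm]
  simp only [ite_mul, one_mul, zero_mul, Finset.sum_ite_eq', Finset.mem_univ, if_true]
  simp only [← Finset.sum_mul]
  rw [hP, one_mul]

theorem IsCyclicLimit.contracting (hζ : IsCyclicLimit M G μ ζ) :
    ContractingWith ⟨M.discount, M.discount_nonneg⟩ (periodicBellman ζ M G) := by
  have : Nonempty A := ⟨G.dummy⟩
  refine ⟨?_, LipschitzWith.of_dist_le_mul fun Q Q' => ?_⟩
  · exact_mod_cast M.discount_lt_one
  have hd : ∀ ℓ z a, |Q ℓ z a - Q' ℓ z a| ≤ dist Q Q' := fun ℓ z a => by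
    rw [← Real.dist_eq]
    exact (dist_le_pi_dist (Q ℓ z) (Q' ℓ z) a).trans
      ((dist_le_pi_dist (Q ℓ) (Q' ℓ) z).trans (dist_le_pi_dist Q Q' ℓ))
  have hs : ∀ ℓ z, |(⨆ a, Q ℓ z a) - ⨆ a, Q' ℓ z a| ≤ dist Q Q' := fun ℓ z => by
    have hb : ∀ R : Fin L → Z → A → ℝ, BddAbove (Set.range (R ℓ z)) :=
      fun R => (Set.finite_range _).bddAbove
    rw [abs_sub_le_iff]
    constructor
    · rw [sub_le_iff_le_add]
      exact ciSup_le fun a => by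
        have := (abs_sub_le_iff.1 (hd ℓ z a)).1
        have := le_ciSup (hb Q') a
        linarith
    · rw [sub_le_iff_le_add]
      exact ciSup_le fun a => by
        have := (abs_sub_le_iff.1 (hd ℓ z a)).2
        have := le_ciSup (hb Q) a
        linarith
  have hK : 0 ≤ M.discount * dist Q Q' := mul_nonneg M.discount_nonneg dist_nonneg
  change dist _ _ ≤ M.discount * dist Q Q'
  refine (dist_pi_le_iff hK).2 fun ℓ => (dist_pi_le_iff hK).2 fun z =>
    (dist_pi_le_iff hK).2 fun a => ?_
  rw [Real.dist_eq]
  simp only [periodicBellman]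
  rw [add_sub_add_left_eq_sub, ← mul_sub, ← Finset.sum_sub_distrib, abs_mul,
    abs_of_nonneg M.discount_nonneg]
  refine mul_le_mul_of_nonneg_left ?_ M.discount_nonneg
  calc _ ≤ ∑ z', |periodicTrans ζ M G ℓ z a z' * (⨆ a', Q (phase L (ℓ + 1)) z' a') -
            periodicTrans ζ M G ℓ z a z' * ⨆ a', Q' (phase L (ℓ + 1)) z' a'| :=
          Finset.abs_sum_le_sum_abs _ _
    _ ≤ ∑ z', periodicTrans ζ M G ℓ z a z' * dist Q Q' := by
          refine Finset.sum_le_sum fun z' _ => ?_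
          rw [← mul_sub, abs_mul, abs_of_nonneg (hζ.periodicTrans_nonneg ℓ z a z')]
          exact mul_le_mul_of_nonneg_left (hs _ _) (hζ.periodicTrans_nonneg ℓ z a z')
    _ = dist Q Q' := by rw [← Finset.sum_mul, hζ.sum_periodicTrans, one_mul]

/-- The cyclic limit `(Q^0_μ, …, Q^{L-1}_μ)`: the unique fixed point of the dynamic program of the
periodic MDP `(r^ℓ_μ, P^ℓ_μ)`. -/
def limitQ (hζ : IsCyclicLimit M G μ ζ) : Fin L → Z → A → ℝ :=
  ContractingWith.fixedPoint (periodicBellman ζ M G) hζ.contracting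

/-- `Q_μ` satisfies the dynamic program, and nothing else does. -/
theorem eq_limitQ_iff (hζ : IsCyclicLimit M G μ ζ) (Q : Fin L → Z → A → ℝ) :
    Q = limitQ hζ ↔ ∀ ℓ z a, Q ℓ z a = periodicReward ζ M ℓ z a + M.discount *
      ∑ z', periodicTrans ζ M G ℓ z a z' * ⨆ a', Q (phase L (ℓ + 1)) z' a' := by
  constructor
  · rintro rfl ℓ z a
    have h := hζ.contracting.fixedPoint_isFixedPt
    exact (congrFun (congrFun (congrFun h ℓ) z) a).symm
  · intro h
    refine hζ.contracting.fixedPoint_unique ?_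
    funext ℓ z a
    exact (h ℓ z a).symm

/-- `V^ℓ_μ(z) = max_a Q^ℓ_μ(z, a)`. -/
def limitV (hζ : IsCyclicLimit M G μ ζ) (ℓ : Fin L) (z : Z) : ℝ :=
  ⨆ a, limitQ hζ ℓ z a

end Fixed

/-- The integral probability metric `d_F` between two laws on the finite set `Z`. -/
def ipm (F : Set (Z → ℝ)) (ξ₁ ξ₂ : Z → ℝ) : ℝ≥0∞ :=
  ⨆ f ∈ F, ENNReal.ofReal |∑ z, f z * ξ₁ z - ∑ z, f z * ξ₂ z|

/-- The Minkowski functional `ρ_F(f) = inf {ρ > 0 : f / ρ ∈ F}`, with `inf ∅ = ∞`. -/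
def minkowski (F : Set (Z → ℝ)) (f : Z → ℝ) : ℝ≥0∞ :=
  ⨅ (c : ℝ) (_ : 0 < c ∧ (fun z => f z / c) ∈ F), ENNReal.ofReal c

/-- The product of two extended nonnegative numbers that is infinite as soon as one factor is
infinite (so `0 · ∞ = ∞`). -/
def extMul (x y : ℝ≥0∞) : ℝ≥0∞ :=
  if x = ∞ ∨ y = ∞ then ∞ else x * y

/-- `ε^ℓ_t`: the worst reward prediction error over the times `τ ≥ t` with `τ ≡ ℓ (mod L)`, all
reachable histories `h_τ` and all actions. -/
def rewardError {L : ℕ} [NeZero L] (M : POMDP S Y A) (G : AgentState Y A Z)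
    (ζ : Fin L → S → Y → Z → A → ℝ) (ℓ : Fin L) (t : ℕ) : ℝ≥0∞ :=
  ⨆ (τ : ℕ) (_ : t ≤ τ ∧ phase L τ = ℓ) (h : History Y A) (_ : h.time = τ ∧ M.Reachable h) (a : A),
    ENNReal.ofReal |M.condReward h a - ∑ s, M.reward s a * condStateAct ζ ℓ (G.unroll h) a s|

/-- `δ^ℓ_t`: the worst error, in the metric `d_F`, of the prediction of the next agent state over
the times `τ ≥ t` with `τ ≡ ℓ (mod L)`, all reachable histories `h_τ` and all actions. -/
def transError [DecidableEq Z] {L : ℕ} [NeZero L] (M : POMDP S Y A) (G : AgentState Y A Z)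
    (ζ : Fin L → S → Y → Z → A → ℝ) (F : Set (Z → ℝ)) (ℓ : Fin L) (t : ℕ) : ℝ≥0∞ :=
  ⨆ (τ : ℕ) (_ : t ≤ τ ∧ phase L τ = ℓ) (h : History Y A) (_ : h.time = τ ∧ M.Reachable h) (a : A),
    ipm F (nextAgentLaw M G h a) (periodicTrans ζ M G ℓ (G.unroll h) a)

/-- The sub-optimality gap `sup_{h_t} [V^⋆_t(h_t) - V^π_t(h_t)]` at time `t` over the reachable
histories, for value functions with weights `γ^(k + τ - t)`, `τ ≥ t`. Each difference is
nonnegative. -/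
def POMDP.gap (M : POMDP S Y A) (k : ℕ) (π : Policy Y A) (t : ℕ) : ℝ≥0∞ :=
  ⨆ (h : History Y A) (_ : h.time = t ∧ M.Reachable h),
    ENNReal.ofReal (M.optValue k h - M.value k π h)

end Model

end PASQL

end

open Filter Topology
open scoped ENNReal

noncomputable section

namespace PASQL

section Model

variable {S Y Z A : Type*} [Fintype S] [Fintype Y] [Fintype Z] [Fintype A]

/-- The probability of the observations of a history when its actions are applied. -/
def POMDP.mass (M : POMDP S Y A) (h : History Y A) : ℝ := ∑ s, M.weight h s

/-- `ℙ(y_{t+1} = y | h_t, a_t)`. -/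
def POMDP.obsProb (M : POMDP S Y A) (h : History Y A) (a : A) (y : Y) : ℝ :=
  M.mass (h.snoc a y) / M.mass h

/-- `𝔼^π[R_{t+n} | h_t]`. -/
def POMDP.meanReward (M : POMDP S Y A) (π : Policy Y A) (n : ℕ) (h : History Y A) : ℝ :=
  ∑ s, M.belief h s * M.expReward π n h s

theorem POMDP.weight_nonneg (M : POMDP S Y A) : ∀ (h : History Y A) (s : S), 0 ≤ M.weight h s
  | .start y, s => M.init.2.1 (s, y)
  | .snoc h a y, s' => Finset.sum_nonneg fun s _ =>
      mul_nonneg (M.weight_nonneg h s) ((M.trans s a).2.1 (s', y))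

theorem POMDP.mass_nonneg (M : POMDP S Y A) (h : History Y A) : 0 ≤ M.mass h :=
  Finset.sum_nonneg fun s _ => M.weight_nonneg h s

theorem POMDP.belief_nonneg (M : POMDP S Y A) (h : History Y A) (s : S) : 0 ≤ M.belief h s :=
  div_nonneg (M.weight_nonneg h s) (M.mass_nonneg h)

theorem POMDP.sum_belief (M : POMDP S Y A) {h : History Y A} (hh : M.Reachable h) :
    ∑ s, M.belief h s = 1 := by
  simp only [POMDP.belief]
  rw [← Finset.sum_div, div_self (ne_of_gt hh)]

theorem POMDP.obsProb_nonneg (M : POMDP S Y A) (h : History Y A) (a : A) (y : Y) :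
    0 ≤ M.obsProb h a y :=
  div_nonneg (M.mass_nonneg _) (M.mass_nonneg h)

theorem POMDP.obsProb_eq_zero (M : POMDP S Y A) {h : History Y A} {a : A} {y : Y}
    (hh : ¬ M.Reachable (h.snoc a y)) : M.obsProb h a y = 0 := by
  have : M.mass (h.snoc a y) = 0 := le_antisymm (not_lt.1 hh) (M.mass_nonneg _)
  rw [POMDP.obsProb, this, zero_div]

/-- Bayes' rule: the filtering step. -/
theorem POMDP.sum_belief_mul_trans (M : POMDP S Y A) (h : History Y A) (a : A) (y : Y) (s' : S) :
    ∑ s, M.belief h s * M.trans s a (s', y) =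
      M.obsProb h a y * M.belief (h.snoc a y) s' := by
  have h1 : ∑ s, M.belief h s * M.trans s a (s', y) = M.weight (h.snoc a y) s' / M.mass h := by
    simp only [POMDP.belief, POMDP.weight, POMDP.mass, Finset.sum_div]
    exact Finset.sum_congr rfl fun s _ => div_mul_eq_mul_div _ _ _
  rw [h1]
  by_cases h0 : M.mass (h.snoc a y) = 0
  · have : M.weight (h.snoc a y) s' = 0 :=
      (Finset.sum_eq_zero_iff_of_nonneg fun s _ => M.weight_nonneg _ s).1 h0 s' (Finset.mem_univ _)
    rw [this, POMDP.obsProb, h0]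
    simp
  · change _ = M.mass (h.snoc a y) / M.mass h * (M.weight (h.snoc a y) s' / M.mass (h.snoc a y))
    field_simp

/-- Averaging a function of the next state and observation. -/
theorem POMDP.sum_belief_mul_sum_trans (M : POMDP S Y A) (h : History Y A) (a : A)
    (f : S × Y → ℝ) :
    ∑ s, M.belief h s * ∑ x, M.trans s a x * f x =
      ∑ y, M.obsProb h a y * ∑ s', M.belief (h.snoc a y) s' * f (s', y) := by
  calc ∑ s, M.belief h s * ∑ x, M.trans s a x * f x
      = ∑ x, (∑ s, M.belief h s * M.trans s a x) * f x := by
        simp only [Finset.mul_sum, Finset.sum_mul]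
        rw [Finset.sum_comm]
        exact Finset.sum_congr rfl fun x _ => Finset.sum_congr rfl fun s _ => by ring
    _ = ∑ y, ∑ s', (∑ s, M.belief h s * M.trans s a (s', y)) * f (s', y) :=
        Fintype.sum_prod_type_right _
    _ = _ := by
        refine Finset.sum_congr rfl fun y _ => ?_
        rw [Finset.mul_sum]
        exact Finset.sum_congr rfl fun s' _ => by rw [M.sum_belief_mul_trans]; ring

theorem POMDP.sum_obsProb_mul (M : POMDP S Y A) (h : History Y A) (a : A) (f : Y → ℝ) :
    ∑ s, M.belief h s * ∑ x, M.trans s a x * f x.2 = ∑ y, M.obsProb h a y * f y := by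
  rw [M.sum_belief_mul_sum_trans h a fun x => f x.2]
  refine Finset.sum_congr rfl fun y _ => ?_
  by_cases hr : M.Reachable (h.snoc a y)
  · simp only [← Finset.sum_mul, M.sum_belief hr, one_mul]
  · rw [M.obsProb_eq_zero hr, zero_mul, zero_mul]

theorem POMDP.sum_obsProb (M : POMDP S Y A) {h : History Y A} (hh : M.Reachable h) (a : A) :
    ∑ y, M.obsProb h a y = 1 := by
  have h1 := M.sum_obsProb_mul h a fun _ => 1
  simp only [mul_one] at h1
  rw [← h1, ← M.sum_belief hh]
  exact Finset.sum_congr rfl fun s _ => by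
    rw [show ∑ x, M.trans s a x = 1 from (M.trans s a).2.2, mul_one]

theorem POMDP.meanReward_zero (M : POMDP S Y A) (π : Policy Y A) (h : History Y A) :
    M.meanReward π 0 h = ∑ a, π h a * M.condReward h a := by
  simp only [POMDP.meanReward, POMDP.expReward, POMDP.condReward, Finset.mul_sum]
  rw [Finset.sum_comm]
  exact Finset.sum_congr rfl fun a _ => Finset.sum_congr rfl fun s _ => by ring

theorem POMDP.meanReward_succ (M : POMDP S Y A) (π : Policy Y A) (n : ℕ) (h : History Y A) :
    M.meanReward π (n + 1) h =
      ∑ a, π h a * ∑ y, M.obsProb h a y * M.meanReward π n (h.snoc a y) := by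
  simp only [POMDP.meanReward]
  calc ∑ s, M.belief h s * M.expReward π (n + 1) h s
      = ∑ a, π h a * ∑ s, M.belief h s *
          ∑ x : S × Y, M.trans s a x * M.expReward π n (h.snoc a x.2) x.1 := by
        simp only [POMDP.expReward]
        simp only [Finset.mul_sum (s := (Finset.univ : Finset A)),
          Finset.mul_sum (s := (Finset.univ : Finset S))]
        rw [Finset.sum_comm]
        exact Finset.sum_congr rfl fun a _ => Finset.sum_congr rfl fun s _ => by ring
    _ = _ := Finset.sum_congr rfl fun a _ => by
        rw [M.sum_belief_mul_sum_trans h a fun x => M.expReward π n (h.snoc a x.2) x.1]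

theorem POMDP.expReward_mem (M : POMDP S Y A) (π : Policy Y A) :
    ∀ (n : ℕ) (h : History Y A) (s : S), M.expReward π n h s ∈ Set.Icc 0 M.rewardMax := by
  have avg : ∀ {ι : Type _} [Fintype ι] (p : stdSimplex ℝ ι) (f : ι → ℝ),
      (∀ i, f i ∈ Set.Icc 0 M.rewardMax) → ∑ i, p i * f i ∈ Set.Icc 0 M.rewardMax :=
    fun p f hf => (convex_Icc (0 : ℝ) M.rewardMax).sum_mem (fun i _ => p.2.1 i) p.2.2
      fun i _ => hf i
  intro n
  induction n with
  | zero => exact fun h s => avg (π h) _ fun a => M.reward_mem s a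
  | succ n ih =>
    intro h s
    refine (convex_Icc (0 : ℝ) M.rewardMax).sum_mem (fun a _ => (π h).2.1 a) (π h).2.2 fun a _ => ?_
    exact (convex_Icc (0 : ℝ) M.rewardMax).sum_mem (fun x _ => (M.trans s a).2.1 x)
      (M.trans s a).2.2 fun x _ => ih _ _

theorem POMDP.meanReward_mem (M : POMDP S Y A) (π : Policy Y A) (n : ℕ) {h : History Y A}
    (hh : M.Reachable h) : M.meanReward π n h ∈ Set.Icc 0 M.rewardMax :=
  (convex_Icc (0 : ℝ) M.rewardMax).sum_mem (fun s _ => M.belief_nonneg h s) (M.sum_belief hh)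
    fun s _ => M.expReward_mem π n h s

theorem POMDP.summable_value (M : POMDP S Y A) (π : Policy Y A) {h : History Y A}
    (hh : M.Reachable h) : Summable fun n : ℕ => M.discount ^ n * M.meanReward π n h := by
  refine Summable.of_nonneg_of_le
    (fun n => mul_nonneg (pow_nonneg M.discount_nonneg n) (M.meanReward_mem π n hh).1)
    (fun n => mul_le_mul_of_nonneg_left (M.meanReward_mem π n hh).2
      (pow_nonneg M.discount_nonneg n))
    ((summable_geometric_of_lt_one M.discount_nonneg M.discount_lt_one).mul_right _)

theorem POMDP.value_zero_eq (M : POMDP S Y A) (π : Policy Y A) (h : History Y A) :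
    M.value 0 π h = ∑' n : ℕ, M.discount ^ n * M.meanReward π n h := by
  simp only [POMDP.value, POMDP.meanReward, zero_add]

theorem POMDP.value_eq_pow_mul (M : POMDP S Y A) (k : ℕ) (π : Policy Y A) (h : History Y A) :
    M.value k π h = M.discount ^ k * M.value 0 π h := by
  simp only [POMDP.value, zero_add, pow_add, mul_assoc]
  rw [tsum_mul_left]

theorem POMDP.optValue_eq_pow_mul (M : POMDP S Y A) (k : ℕ) (h : History Y A) :
    M.optValue k h = M.discount ^ k * M.optValue 0 h := by
  simp only [POMDP.optValue, M.value_eq_pow_mul k]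
  rw [Real.mul_iSup_of_nonneg (pow_nonneg M.discount_nonneg k)]

theorem POMDP.value_mem (M : POMDP S Y A) (π : Policy Y A) {h : History Y A}
    (hh : M.Reachable h) :
    M.value 0 π h ∈ Set.Icc 0 ((1 - M.discount)⁻¹ * M.rewardMax) := by
  rw [M.value_zero_eq]
  refine ⟨tsum_nonneg fun n =>
    mul_nonneg (pow_nonneg M.discount_nonneg n) (M.meanReward_mem π n hh).1, ?_⟩
  rw [← tsum_geometric_of_lt_one M.discount_nonneg M.discount_lt_one, ← tsum_mul_right]
  exact (M.summable_value π hh).tsum_le_tsum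
    (fun n => mul_le_mul_of_nonneg_left (M.meanReward_mem π n hh).2
      (pow_nonneg M.discount_nonneg n))
    ((summable_geometric_of_lt_one M.discount_nonneg M.discount_lt_one).mul_right _)

/-- The Bellman equation of a history dependent policy. -/
theorem POMDP.value_bellman (M : POMDP S Y A) (π : Policy Y A) {h : History Y A}
    (hh : M.Reachable h) :
    M.value 0 π h = ∑ a, π h a * (M.condReward h a +
      M.discount * ∑ y, M.obsProb h a y * M.value 0 π (h.snoc a y)) := by
  have hs : ∀ a y, Summable fun n : ℕ =>
      M.obsProb h a y * (M.discount ^ n * M.meanReward π n (h.snoc a y)) := fun a y => by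
    by_cases hr : M.Reachable (h.snoc a y)
    · exact (M.summable_value π hr).mul_left _
    · simp [M.obsProb_eq_zero hr]
  have hs' : ∀ a, Summable fun n : ℕ =>
      π h a * ∑ y, M.obsProb h a y * (M.discount ^ n * M.meanReward π n (h.snoc a y)) :=
    fun a => (summable_sum fun y _ => hs a y).mul_left _
  rw [M.value_zero_eq, (M.summable_value π hh).tsum_eq_zero_add, pow_zero, one_mul,
    M.meanReward_zero]
  have hterm : ∀ n : ℕ, M.discount ^ (n + 1) * M.meanReward π (n + 1) h =
      M.discount * ∑ a, π h a *
        ∑ y, M.obsProb h a y * (M.discount ^ n * M.meanReward π n (h.snoc a y)) := fun n => by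
    rw [M.meanReward_succ]
    simp only [Finset.mul_sum]
    exact Finset.sum_congr rfl fun a _ => Finset.sum_congr rfl fun y _ => by ring
  simp only [hterm]
  rw [tsum_mul_left, Summable.tsum_finsetSum fun a _ => hs' a, Finset.mul_sum,
    ← Finset.sum_add_distrib]
  refine Finset.sum_congr rfl fun a _ => ?_
  rw [tsum_mul_left, Summable.tsum_finsetSum fun y _ => hs a y]
  simp only [tsum_mul_left, M.value_zero_eq]
  ring

/-- Iterating a one-step error inequality along reachable histories. -/
theorem POMDP.error_propagation (M : POMDP S Y A) (e : ℕ → ℝ≥0∞) (X : History Y A → ℝ) (C : ℝ)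
    (hC : ∀ h, M.Reachable h → X h ≤ C)
    (hX : ∀ h, M.Reachable h → ∀ B : ℝ, 0 ≤ B →
      (∀ a y, M.Reachable (h.snoc a y) → X (h.snoc a y) ≤ B) →
      ENNReal.ofReal (X h) ≤ e h.time + ENNReal.ofReal (M.discount * B))
    {h : History Y A} (hh : M.Reachable h) :
    ENNReal.ofReal (X h) ≤ ∑' n : ℕ, ENNReal.ofReal M.discount ^ n * e (h.time + n) := by
  set γ := ENNReal.ofReal M.discount with hγ
  have step : ∀ h, M.Reachable h → ∀ B : ℝ≥0∞,
      (∀ a y, M.Reachable (h.snoc a y) → ENNReal.ofReal (X (h.snoc a y)) ≤ B) →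
      ENNReal.ofReal (X h) ≤ e h.time + γ * B := by
    intro h hh B hB
    by_cases hBt : B = ∞
    · rcases M.discount_nonneg.eq_or_lt with h0 | h0
      · have h1 := hX h hh (max C 0) (le_max_right _ _) fun a y hr =>
          (hC _ hr).trans (le_max_left _ _)
        rw [← h0, zero_mul, ENNReal.ofReal_zero] at h1
        exact h1.trans (add_le_add_right zero_le _)
      · rw [hBt, ENNReal.mul_top (by simpa [hγ] using h0), add_top]
        exact le_top
    · have h1 := hX h hh B.toReal ENNReal.toReal_nonneg fun a y hr =>
        (ENNReal.ofReal_le_iff_le_toReal hBt).1 (hB a y hr)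
      rwa [ENNReal.ofReal_mul M.discount_nonneg, ENNReal.ofReal_toReal hBt] at h1
  have main : ∀ n : ℕ, ∀ h, M.Reachable h → ENNReal.ofReal (X h) ≤
      ∑ m ∈ Finset.range n, γ ^ m * e (h.time + m) + γ ^ n * ENNReal.ofReal C := by
    intro n
    induction n with
    | zero => intro h hh; simpa using ENNReal.ofReal_le_ofReal (hC h hh)
    | succ n ih =>
      intro h hh
      refine (step h hh (∑ m ∈ Finset.range n, γ ^ m * e (h.time + 1 + m) +
        γ ^ n * ENNReal.ofReal C) fun a y hr => ih _ hr).trans (le_of_eq ?_)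
      rw [Finset.sum_range_succ', mul_add, Finset.mul_sum]
      simp only [pow_zero, one_mul, add_zero, pow_succ']
      simp only [mul_assoc, add_assoc, add_comm 1]
      exact add_left_comm _ _ _
  have hγ1 : γ < 1 := by
    rw [hγ, ← ENNReal.ofReal_one]
    exact (ENNReal.ofReal_lt_ofReal_iff one_pos).2 M.discount_lt_one
  have hlim : Tendsto (fun n : ℕ => (∑' m : ℕ, γ ^ m * e (h.time + m)) +
      γ ^ n * ENNReal.ofReal C) atTop (𝓝 ((∑' m : ℕ, γ ^ m * e (h.time + m)) + 0)) := by
    refine tendsto_const_nhds.add ?_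
    have := ENNReal.Tendsto.mul_const (ENNReal.tendsto_pow_atTop_nhds_zero_of_lt_one hγ1)
      (Or.inr (ENNReal.ofReal_ne_top (r := C)))
    simpa using this
  rw [add_zero] at hlim
  exact ge_of_tendsto' hlim fun n => (main n h hh).trans (add_le_add_left (ENNReal.sum_le_tsum _) _)

section Prediction

variable [DecidableEq Z] {L : ℕ} [NeZero L] {M : POMDP S Y A} {G : AgentState Y A Z}
  {μ : Fin L → Z → stdSimplex ℝ A} {ζ : Fin L → S → Y → Z → A → ℝ}

theorem phase_mul_add (k : ℕ) (ℓ : Fin L) : phase L (k * L + ℓ) = ℓ := by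
  apply Fin.ext
  simp [phase, Nat.mod_eq_of_lt ℓ.2]

theorem phase_phase_add_one (t : ℕ) : phase L (phase L t + 1) = phase L (t + 1) := by
  apply Fin.ext
  simp [phase]

/-- Under the behavior policy, the action at a positive time is drawn given the agent state. -/
theorem behaviorLaw_eq_mul (t : ℕ) (s : S) (y : Y) (z : Z) (a : A) :
    behaviorLaw M G μ t s y z a =
      (∑ a', behaviorLaw M G μ t s y z a') * μ (phase L t) z a := by
  have h1 : ∀ ℓ, ∑ a', μ ℓ z a' = 1 := fun ℓ => (μ ℓ z).2.2
  match t with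
  | 0 => simp [behaviorLaw]
  | 1 =>
    simp only [behaviorLaw]
    rw [← Finset.mul_sum, h1, mul_one]
  | t + 2 =>
    simp only [behaviorLaw, ← Finset.sum_mul]
    rw [← Finset.mul_sum, h1, mul_one]

theorem IsCyclicLimit.eq_mul (hζ : IsCyclicLimit M G μ ζ) (ℓ : Fin L) (s : S) (y : Y) (z : Z)
    (a : A) : ζ ℓ s y z a = (∑ a', ζ ℓ s y z a') * μ ℓ z a := by
  have h : ∀ a, Tendsto (fun k : ℕ => behaviorLaw M G μ (k * L + ℓ) s y z a) atTop
      (𝓝 (ζ ℓ s y z a)) := fun a => by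
    have h := hζ.tendsto ℓ
    rw [tendsto_pi_nhds] at h
    exact tendsto_pi_nhds.1 (tendsto_pi_nhds.1 (tendsto_pi_nhds.1 (h s) y) z) a
  refine tendsto_nhds_unique (h a) ?_
  refine ((tendsto_finsetSum _ fun a' _ => h a').mul_const (μ ℓ z a)).congr fun k => ?_
  rw [behaviorLaw_eq_mul (k * L + ℓ) s y z a, phase_mul_add]

/-- The state and the action are conditionally independent given the agent state. -/
theorem IsCyclicLimit.condStateAct_eq (hζ : IsCyclicLimit M G μ ζ) (ℓ : Fin L) (z : Z) (a : A)
    (s : S) : condStateAct ζ ℓ z a s = condState ζ ℓ z s := by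
  have h1 : ∀ s, ∑ y, ζ ℓ s y z a = (∑ y, ∑ a', ζ ℓ s y z a') * μ ℓ z a := fun s => by
    rw [Finset.sum_mul]
    exact Finset.sum_congr rfl fun y _ => hζ.eq_mul ℓ s y z a
  have hμ : μ ℓ z a ≠ 0 := fun h0 => by
    have := hζ.pos ℓ z a
    simp [h1, h0] at this
  simp only [condStateAct, condState, h1]
  rw [← Finset.sum_mul, mul_div_mul_right _ _ hμ]

theorem rewardError_ge (hζ : IsCyclicLimit M G μ ζ) {h : History Y A} (hh : M.Reachable h)
    (a : A) :
    ENNReal.ofReal |M.condReward h a - periodicReward ζ M (phase L h.time) (G.unroll h) a| ≤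
      rewardError M G ζ (phase L h.time) h.time := by
  have h1 : periodicReward ζ M (phase L h.time) (G.unroll h) a =
      ∑ s, M.reward s a * condStateAct ζ (phase L h.time) (G.unroll h) a s := by
    simp only [periodicReward, hζ.condStateAct_eq]
  rw [h1]
  exact le_iSup₂_of_le h.time ⟨le_rfl, rfl⟩ <| le_iSup₂_of_le h ⟨rfl, hh⟩ <| le_iSup_of_le a le_rfl

theorem sum_nextAgentLaw_mul (h : History Y A) (a : A) (f : Z → ℝ) :
    ∑ z, f z * nextAgentLaw M G h a z =
      ∑ y, M.obsProb h a y * f (G.unroll (h.snoc a y)) := by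
  rw [← M.sum_obsProb_mul h a fun y => f (G.unroll (h.snoc a y))]
  simp only [nextAgentLaw, Finset.mul_sum]
  rw [Finset.sum_comm]
  refine Finset.sum_congr rfl fun s _ => ?_
  rw [Finset.sum_comm]
  refine Finset.sum_congr rfl fun x _ => ?_
  rw [Finset.sum_eq_single (G.update (G.unroll h) x.2 a)]
  · simp only [if_true, AgentState.unroll]
    ring
  · intro z _ hz
    simp [hz]
  · simp

theorem ofReal_integral_sub_le (F : Set (Z → ℝ)) (f ξ₁ ξ₂ : Z → ℝ) {d : ℝ≥0∞}
    (hd : ipm F ξ₁ ξ₂ ≤ d) :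
    ENNReal.ofReal |∑ z, f z * ξ₁ z - ∑ z, f z * ξ₂ z| ≤ extMul d (minkowski F f) := by
  unfold extMul
  split_ifs with htop
  · exact le_top
  push Not at htop
  have hm : minkowski F f = ⨅ c : {c : ℝ // 0 < c ∧ (fun z => f z / c) ∈ F},
      ENNReal.ofReal c := by
    rw [minkowski, iInf_subtype']
  have hne : Nonempty {c : ℝ // 0 < c ∧ (fun z => f z / c) ∈ F} := by
    by_contra hemp
    rw [not_nonempty_iff] at hemp
    exact htop.2 (by rw [hm, iInf_of_empty])
  rw [hm, ENNReal.mul_iInf fun h => absurd h htop.1]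
  refine le_iInf fun ⟨c, hc, hf⟩ => ?_
  have h1 : ENNReal.ofReal |∑ z, f z / c * ξ₁ z - ∑ z, f z / c * ξ₂ z| ≤ d :=
    (le_iSup₂ (f := fun (f : Z → ℝ) (_ : f ∈ F) =>
      ENNReal.ofReal |∑ z, f z * ξ₁ z - ∑ z, f z * ξ₂ z|) _ hf).trans hd
  have h2 : |∑ z, f z * ξ₁ z - ∑ z, f z * ξ₂ z| =
      |∑ z, f z / c * ξ₁ z - ∑ z, f z / c * ξ₂ z| * c := by
    rw [← abs_of_pos hc, ← abs_mul, abs_of_pos hc, sub_mul, Finset.sum_mul, Finset.sum_mul]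
    congr 2 <;> exact Finset.sum_congr rfl fun z _ => by field_simp
  rw [h2, ENNReal.ofReal_mul (abs_nonneg _)]
  gcongr

/-- The one-step prediction error `ε^{[t]}_t + γ δ^{[t]}_t ρ_F(V^{[t+1]})`. -/
def stepError (hζ : IsCyclicLimit M G μ ζ) (F : Set (Z → ℝ)) (t : ℕ) : ℝ≥0∞ :=
  rewardError M G ζ (phase L t) t + ENNReal.ofReal M.discount *
    extMul (transError M G ζ F (phase L t) t) (minkowski F (limitV hζ (phase L (t + 1))))

theorem stepError_add_mul_le (hζ : IsCyclicLimit M G μ ζ) (F : Set (Z → ℝ)) (t k : ℕ) :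
    stepError hζ F (t + k * L) ≤ stepError hζ F t := by
  have hp : ∀ t, phase L (t + k * L) = phase L t := fun t => by
    apply Fin.ext
    simp [phase]
  have hr : rewardError M G ζ (phase L t) (t + k * L) ≤ rewardError M G ζ (phase L t) t :=
    iSup_mono fun τ => iSup_mono' fun hτ => ⟨⟨(Nat.le_add_right _ _).trans hτ.1, hτ.2⟩, le_rfl⟩
  have hd : transError M G ζ F (phase L t) (t + k * L) ≤ transError M G ζ F (phase L t) t :=
    iSup_mono fun τ => iSup_mono' fun hτ => ⟨⟨(Nat.le_add_right _ _).trans hτ.1, hτ.2⟩, le_rfl⟩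
  have hm : ∀ {x x' y : ℝ≥0∞}, x ≤ x' → extMul x y ≤ extMul x' y := fun {x x' y} hx => by
    unfold extMul
    split_ifs with h1 h2 h2
    · exact le_rfl
    · exfalso
      rcases h1 with h1 | h1
      · exact h2 (Or.inl (top_le_iff.1 (h1 ▸ hx)))
      · exact h2 (Or.inr h1)
    · exact le_top
    · gcongr
  have hq : phase L (t + k * L + 1) = phase L (t + 1) := by rw [add_right_comm, hp]
  unfold stepError
  rw [hp, hq]
  exact add_le_add hr (mul_le_mul_right (hm hd) _)

theorem limitQ_le_limitV (hζ : IsCyclicLimit M G μ ζ) (ℓ : Fin L) (z : Z) (a : A) :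
    limitQ hζ ℓ z a ≤ limitV hζ ℓ z :=
  le_ciSup (Set.finite_range (limitQ hζ ℓ z)).bddAbove a

/-- The value function of the periodic limit, as a function of the history. -/
def historyV (hζ : IsCyclicLimit M G μ ζ) (h : History Y A) : ℝ :=
  limitV hζ (phase L h.time) (G.unroll h)

/-- The one-step prediction error of the limit `Q_μ` at a reachable history. -/
theorem ofReal_prediction_error_le (hζ : IsCyclicLimit M G μ ζ) (F : Set (Z → ℝ))
    {h : History Y A} (hh : M.Reachable h) (a : A) :
    ENNReal.ofReal |M.condReward h a +
        M.discount * ∑ y, M.obsProb h a y * historyV hζ (h.snoc a y) -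
      limitQ hζ (phase L h.time) (G.unroll h) a| ≤ stepError hζ F h.time := by
  set ℓ := phase L h.time with hℓ
  set V := limitV hζ (phase L (h.time + 1)) with hV
  have h1 : ∑ y, M.obsProb h a y * historyV hζ (h.snoc a y) =
      ∑ z, V z * nextAgentLaw M G h a z := by
    rw [sum_nextAgentLaw_mul]
    rfl
  have h2 : limitQ hζ ℓ (G.unroll h) a = periodicReward ζ M ℓ (G.unroll h) a + M.discount *
      ∑ z, V z * periodicTrans ζ M G ℓ (G.unroll h) a z := by
    rw [(eq_limitQ_iff hζ _).1 rfl ℓ, hℓ, phase_phase_add_one]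
    simp only [mul_comm (V _)]
    rfl
  have ht : ipm F (nextAgentLaw M G h a) (periodicTrans ζ M G ℓ (G.unroll h) a) ≤
      transError M G ζ F ℓ h.time :=
    le_iSup₂_of_le h.time ⟨le_rfl, rfl⟩ <| le_iSup₂_of_le h ⟨rfl, hh⟩ <| le_iSup_of_le a le_rfl
  rw [h1, h2, add_sub_add_comm, ← mul_sub]
  refine (ENNReal.ofReal_le_ofReal (abs_add_le _ _)).trans ?_
  rw [ENNReal.ofReal_add (abs_nonneg _) (abs_nonneg _), abs_mul, abs_of_nonneg M.discount_nonneg,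
    ENNReal.ofReal_mul M.discount_nonneg]
  exact add_le_add (rewardError_ge hζ hh a)
    (mul_le_mul_right (ofReal_integral_sub_le F V _ _ ht) _)

theorem exists_abs_historyV_le (hζ : IsCyclicLimit M G μ ζ) :
    ∃ C, ∀ h, |historyV hζ h| ≤ C := by
  obtain ⟨C, hC⟩ := (Set.finite_range
    fun p : Fin L × Z => |limitV hζ p.1 p.2|).bddAbove
  exact ⟨C, fun h => hC ⟨(phase L h.time, G.unroll h), rfl⟩⟩

theorem ofReal_value_sub_historyV_le (hζ : IsCyclicLimit M G μ ζ) (F : Set (Z → ℝ))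
    (π : Policy Y A) {h : History Y A} (hh : M.Reachable h) :
    ENNReal.ofReal (M.value 0 π h - historyV hζ h) ≤
      ∑' n : ℕ, ENNReal.ofReal M.discount ^ n * stepError hζ F (h.time + n) := by
  obtain ⟨C, hC⟩ := exists_abs_historyV_le hζ
  refine M.error_propagation (stepError hζ F) (fun h => M.value 0 π h - historyV hζ h)
    ((1 - M.discount)⁻¹ * M.rewardMax + C) (fun h hr => ?_) (fun h hr B hB hX => ?_) hh
  · linarith [(M.value_mem π hr).2, (abs_le.1 (hC h)).1]
  by_cases htop : stepError hζ F h.time = ∞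
  · rw [htop, top_add]
    exact le_top
  rw [← ENNReal.ofReal_toReal htop, ← ENNReal.ofReal_add ENNReal.toReal_nonneg
    (mul_nonneg M.discount_nonneg hB)]
  refine ENNReal.ofReal_le_ofReal ?_
  rw [sub_le_iff_le_add, M.value_bellman π hr]
  refine (convex_Iic (𝕜 := ℝ) (_ : ℝ)).sum_mem (fun a _ => (π h).2.1 a) (π h).2.2 fun a _ => ?_
  have h1 := (abs_le.1 ((ENNReal.ofReal_le_iff_le_toReal htop).1
    (ofReal_prediction_error_le hζ F hr a))).2
  have h2 : ∑ y, M.obsProb h a y * M.value 0 π (h.snoc a y) ≤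
      ∑ y, M.obsProb h a y * historyV hζ (h.snoc a y) + B := by
    rw [← one_mul B, ← M.sum_obsProb hr a, Finset.sum_mul, ← Finset.sum_add_distrib]
    refine Finset.sum_le_sum fun y _ => ?_
    by_cases hy : M.Reachable (h.snoc a y)
    · rw [← mul_add]
      exact mul_le_mul_of_nonneg_left (by linarith [hX a y hy]) (M.obsProb_nonneg h a y)
    · simp [M.obsProb_eq_zero hy]
  have h3 := mul_le_mul_of_nonneg_left h2 M.discount_nonneg
  have h4 := limitQ_le_limitV hζ (phase L h.time) (G.unroll h) a
  change _ ≤ _ + limitV hζ (phase L h.time) (G.unroll h)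
  linarith

theorem ofReal_historyV_sub_value_le [DecidableEq A] (hζ : IsCyclicLimit M G μ ζ)
    (F : Set (Z → ℝ)) (g : Fin L → Z → A)
    (hg : ∀ ℓ z a, limitQ hζ ℓ z a ≤ limitQ hζ ℓ z (g ℓ z))
    {h : History Y A} (hh : M.Reachable h) :
    ENNReal.ofReal (historyV hζ h - M.value 0 (liftPolicy G g) h) ≤
      ∑' n : ℕ, ENNReal.ofReal M.discount ^ n * stepError hζ F (h.time + n) := by
  have : Nonempty A := ⟨G.dummy⟩
  obtain ⟨C, hC⟩ := exists_abs_historyV_le hζ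
  refine M.error_propagation (stepError hζ F)
    (fun h => historyV hζ h - M.value 0 (liftPolicy G g) h) C (fun h hr => ?_)
    (fun h hr B hB hX => ?_) hh
  · linarith [(M.value_mem (liftPolicy G g) hr).1, (abs_le.1 (hC h)).2]
  by_cases htop : stepError hζ F h.time = ∞
  · rw [htop, top_add]
    exact le_top
  rw [← ENNReal.ofReal_toReal htop, ← ENNReal.ofReal_add ENNReal.toReal_nonneg
    (mul_nonneg M.discount_nonneg hB)]
  refine ENNReal.ofReal_le_ofReal ?_
  set a := g (phase L h.time) (G.unroll h) with ha
  have hval : M.value 0 (liftPolicy G g) h = M.condReward h a +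
      M.discount * ∑ y, M.obsProb h a y * M.value 0 (liftPolicy G g) (h.snoc a y) := by
    rw [M.value_bellman _ hr, Finset.sum_eq_single a]
    · simp [liftPolicy, ← ha]
    · intro b _ hb
      simp [liftPolicy, ← ha, hb]
    · simp
  have h1 := (abs_le.1 ((ENNReal.ofReal_le_iff_le_toReal htop).1
    (ofReal_prediction_error_le hζ F hr a))).1
  have h2 : ∑ y, M.obsProb h a y * historyV hζ (h.snoc a y) ≤
      ∑ y, M.obsProb h a y * M.value 0 (liftPolicy G g) (h.snoc a y) + B := by
    rw [← one_mul B, ← M.sum_obsProb hr a, Finset.sum_mul, ← Finset.sum_add_distrib]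
    refine Finset.sum_le_sum fun y _ => ?_
    by_cases hy : M.Reachable (h.snoc a y)
    · rw [← mul_add]
      exact mul_le_mul_of_nonneg_left (by linarith [hX a y hy]) (M.obsProb_nonneg h a y)
    · simp [M.obsProb_eq_zero hy]
  have h3 := mul_le_mul_of_nonneg_left h2 M.discount_nonneg
  have h4 : historyV hζ h ≤ limitQ hζ (phase L h.time) (G.unroll h) a :=
    ciSup_le fun b => hg _ _ b
  rw [hval]
  linarith

/-- Summing the discounted one-step errors period by period. -/
theorem tsum_stepError_le (hζ : IsCyclicLimit M G μ ζ) (F : Set (Z → ℝ)) (t : ℕ) :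
    ∑' n : ℕ, ENNReal.ofReal M.discount ^ n * stepError hζ F (t + n) ≤
      ENNReal.ofReal (1 / (1 - M.discount ^ L)) *
        ∑ ℓ ∈ Finset.range L, ENNReal.ofReal (M.discount ^ ℓ) * stepError hζ F (t + ℓ) := by
  have hL : M.discount ^ L < 1 :=
    pow_lt_one₀ M.discount_nonneg M.discount_lt_one (NeZero.ne L)
  have hgeo : ENNReal.ofReal (1 / (1 - M.discount ^ L)) =
      ∑' k : ℕ, (ENNReal.ofReal M.discount ^ L) ^ k := by
    rw [ENNReal.tsum_geometric, one_div, ENNReal.ofReal_inv_of_pos (by linarith),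
      ENNReal.ofReal_sub _ (pow_nonneg M.discount_nonneg L), ENNReal.ofReal_one,
      ENNReal.ofReal_pow M.discount_nonneg]
  rw [hgeo, ← (Nat.divModEquiv L).symm.tsum_eq, ENNReal.tsum_prod', ← ENNReal.tsum_mul_right]
  refine ENNReal.tsum_le_tsum fun k => ?_
  rw [tsum_fintype, Finset.mul_sum,
    Finset.sum_range fun ℓ => (ENNReal.ofReal M.discount ^ L) ^ k *
      (ENNReal.ofReal (M.discount ^ ℓ) * stepError hζ F (t + ℓ))]
  refine Finset.sum_le_sum fun ℓ _ => ?_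
  have h1 : (Nat.divModEquiv L).symm (k, ℓ) = ℓ + k * L := by
    simp [Nat.divModEquiv, add_comm, mul_comm]
  rw [h1, ENNReal.ofReal_pow M.discount_nonneg, ← mul_assoc, ← pow_mul, ← pow_add,
    mul_comm L k, add_comm (k * L), ← add_assoc]
  exact mul_le_mul_right (stepError_add_mul_le hζ F _ k) _

theorem gap_zero_le [DecidableEq A] (hζ : IsCyclicLimit M G μ ζ)
    (F : Set (Z → ℝ)) (g : Fin L → Z → A)
    (hg : ∀ ℓ z a, limitQ hζ ℓ z a ≤ limitQ hζ ℓ z (g ℓ z)) (t : ℕ) :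
    M.gap 0 (liftPolicy G g) t ≤
      2 * ∑' n : ℕ, ENNReal.ofReal M.discount ^ n * stepError hζ F (t + n) := by
  refine iSup₂_le fun h ⟨ht, hh⟩ => ?_
  subst ht
  have : Nonempty (Policy Y A) := ⟨liftPolicy G g⟩
  by_cases htop : ∑' n : ℕ, ENNReal.ofReal M.discount ^ n * stepError hζ F (h.time + n) = ∞
  · rw [htop, ENNReal.mul_top two_ne_zero]
    exact le_top
  have h1 := (ENNReal.ofReal_le_iff_le_toReal htop).1 (ofReal_historyV_sub_value_le hζ F g hg hh)
  have h2 : M.optValue 0 h ≤ historyV hζ h + (∑' n : ℕ, ENNReal.ofReal M.discount ^ n *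
      stepError hζ F (h.time + n)).toReal := ciSup_le fun π => by
    linarith [(ENNReal.ofReal_le_iff_le_toReal htop).1
      (ofReal_value_sub_historyV_le hζ F π hh)]
  refine (ENNReal.ofReal_le_iff_le_toReal (ENNReal.mul_ne_top (by simp) htop)).2 ?_
  rw [ENNReal.toReal_mul, ENNReal.toReal_ofNat]
  linarith

end Prediction

theorem POMDP.gap_le_gap_zero (M : POMDP S Y A) (k : ℕ) (π : Policy Y A) (t : ℕ) :
    M.gap k π t ≤ M.gap 0 π t := by
  refine iSup₂_mono fun h _ => ?_
  rw [M.optValue_eq_pow_mul, M.value_eq_pow_mul, ← mul_sub,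
    ENNReal.ofReal_mul (pow_nonneg M.discount_nonneg k)]
  refine mul_le_of_le_one_left' ?_
  rw [← ENNReal.ofReal_one]
  exact ENNReal.ofReal_le_ofReal (pow_le_one₀ M.discount_nonneg M.discount_lt_one.le)

end Model

end PASQL

end

theorem theorem2 {S Y Z A : Type*} [Fintype S] [Fintype Y] [Fintype Z] [Fintype A]
    [DecidableEq Z] [DecidableEq A] {L : ℕ} [NeZero L]
    (M : PASQL.POMDP S Y A) (G : PASQL.AgentState Y A Z)
    (μ : Fin L → Z → stdSimplex ℝ A) (ζ : Fin L → S → Y → Z → A → ℝ)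
    (hζ : PASQL.IsCyclicLimit M G μ ζ)
    (F : Set (Z → ℝ)) (hF_convex : Convex ℝ F) (hF_balanced : Balanced ℝ F)
    (g : Fin L → Z → A)
    (hg : ∀ ℓ z a, PASQL.limitQ hζ ℓ z a ≤ PASQL.limitQ hζ ℓ z (g ℓ z))
    (t : ℕ) (ht : 1 ≤ t) :
    let bound : ℝ≥0∞ := ENNReal.ofReal (2 / (1 - M.discount ^ L)) *
      ∑ ℓ ∈ Finset.range L, ENNReal.ofReal (M.discount ^ ℓ) *
        (PASQL.rewardError M G ζ (PASQL.phase L (t + ℓ)) (t + ℓ) +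
          ENNReal.ofReal M.discount *
            PASQL.extMul (PASQL.transError M G ζ F (PASQL.phase L (t + ℓ)) (t + ℓ))
              (PASQL.minkowski F (PASQL.limitV hζ (PASQL.phase L (t + ℓ + 1)))))
    M.gap t (PASQL.liftPolicy G g) t ≤ bound ∧ M.gap 0 (PASQL.liftPolicy G g) t ≤ bound := by

  intro bound
  have h0 : M.gap 0 (PASQL.liftPolicy G g) t ≤ bound := by
    refine (PASQL.gap_zero_le hζ F g hg t).trans
      ((mul_le_mul_right (PASQL.tsum_stepError_le hζ F t) 2).trans (le_of_eq ?_))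
    rw [← mul_assoc, ← ENNReal.ofReal_ofNat 2, ← ENNReal.ofReal_mul (by norm_num), mul_one_div]
    rfl
  exact ⟨(M.gap_le_gap_zero t _ t).trans h0, h0⟩
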